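/- Let $\mathcal{C}$ be an additive category which is idempotent complete, i.e. every idempotent endomorphism $e:X\to X$ factors as $e=ip$ with $p:X\to Y$, $i:Y\to X$ and $pi=1_Y$. Call an object $K$ of $\mathcal{C}$ compact if for every direct sum (coproduct) $\bigoplus_{i\in I}X_i$ that exists in $\mathcal{C}$ and every morphism $f:K\to\bigoplus_{i\in I}X_i$ there is a finite subset $F\subseteq I$ such that $f$ factors through the canonical morphism $\bigoplus_{i\in F}X_i\to\bigoplus_{i\in I}X_i$. Suppose that $\mathcal{C}$ has enough compact objects, i.e. for every non-zero object $B$ of $\mathcal{C}$ there are a compact object $K$ and a non-zero morphism $K\to B$. Let $(A_i)_{i\in I}$ be a family of objects of $\mathcal{C}$ with local endomorphism rings whose direct sum $\bigoplus_{i\in I}A_i$ exists in $\mathcal{C}$ (as is automatic if $\mathcal{C}$ has all direct sums). (a) If $B$ is an indecomposable object and $\bigoplus_{i\in I}A_i\cong B\oplus D$ for some object $D$, then there exists $i\in I$ such that $B\cong A_i$. (b) If $(B_j)_{j\in J}$ is a family of indecomposable objects whose direct sum exists in $\mathcal{C}$ and $\bigoplus_{i\in I}A_i\cong\bigoplus_{j\in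 J}B_j$, then there exists a bijection $\sigma:I\to J$ such that $A_i\cong B_{\sigma(i)}$ for every $i\in I$. Here an object $X$ is indecomposable if $X\neq 0$ and $X\cong Y\oplus Z$ implies $Y=0$ or $Z=0$. -/

import Mathlib

open CategoryTheory CategoryTheory.Limits

universe w v u

/-- An object `K` of an additive category is compact if every morphism from `K` into a direct sum
`⊕_{i ∈ I} A i` factors through the canonical morphism `⊕_{j ∈ J} A j ⟶ ⊕_{i ∈ I} A i` for some
finite `J ⊆ I`. A direct sum is any colimit cofan `c`; all those that exist in the category, with
index set in `Type w`, are considered. -/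
def IsCompactObj {C : Type u} [Category.{v} C] [Preadditive C] [HasFiniteBiproducts C]
    (K : C) : Prop :=
  ∀ (I : Type w) (A : I → C) (c : Cofan A), Nonempty (IsColimit c) → ∀ f : K ⟶ c.pt,
    ∃ (J : Finset I) (g : K ⟶ ⨁ (fun j : J => A j)),
      g ≫ biproduct.desc (fun j : J => c.inj (j : I)) = f

/-- There are enough compact objects if every nonzero object receives a nonzero morphism from a
compact object. -/
def HasEnoughCompacts (C : Type u) [Category.{v} C] [Preadditive C] [HasFiniteBiproducts C] :
    Prop :=
  ∀ B : C, ¬ IsZero B → ∃ (K : C) (f : K ⟶ B), IsCompactObj.{w} K ∧ f ≠ 0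

/-- `B` is a direct summand of `X`: there is a decomposition `X ≅ B ⊕ D`. -/
def IsDirectSummand {C : Type u} [Category.{v} C] [Preadditive C] [HasBinaryBiproducts C]
    (B X : C) : Prop :=
  ∃ D : C, Nonempty (X ≅ B ⊞ D)

/-! Compact objects replace elements: maps out of a compact `K` detect non-zero objects and see only
finitely many summands. Let `B` be a retract of the coproduct. Its identity is formally the sum of
the endomorphisms of `B` passing through the `A i`. If no `A i` were a retract of `B` in this way,
locality would put each of them in the Jacobson radical; on a non-zero `f : K ⟶ B` the sum is
finite, so a unit would kill `f` (`exists_isIso_of_retract`). For indecomposable `B` this gives (a),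
and so the `B j` in (b) have local endomorphism rings too. For (b), the multiplicities of each
isomorphism class are compared in both directions (`mk_iso_le`): finite ones by linear algebra over
the residue division ring of `End T`, infinite ones by a map of index sets with finite fibres. -/

section LocalRing

/-! ### Noncommutative local rings and the Jacobson radical. -/

variable {R : Type*} [Ring R]

theorem isUnit_one_sub_of_mem_ringJacobson {x : R} (hx : x ∈ Ring.jacobson R) :
    IsUnit (1 - x) := by
  have key : ∀ y : R, ∃ z, z * (1 + y * x) = 1 := by
    intro y
    rw [← Ideal.jacobson_bot, Ideal.mem_jacobson_iff] at hx
    obtain ⟨z, hz⟩ := hx y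
    refine ⟨z, ?_⟩
    rw [Ideal.mem_bot, sub_eq_zero] at hz
    rw [mul_add, mul_one, ← mul_assoc, add_comm, hz]
  obtain ⟨z, hz⟩ := key (-1)
  -- `z` is a left inverse of `1 - x`; as `z = 1 + z * x`, it has a left inverse itself, hence is a
  -- unit.
  obtain ⟨w, hw⟩ := key z
  have hz' : z * (1 - x) = 1 := by
    rwa [neg_one_mul, ← sub_eq_add_neg] at hz
  have hzx : 1 + z * x = z := by
    rw [← hz', mul_sub, mul_one, sub_add_cancel]
  rw [hzx] at hw
  have hwx : w = 1 - x := left_inv_eq_right_inv hw hz'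
  exact ⟨⟨1 - x, z, by rw [← hwx, hw], hz'⟩, rfl⟩

theorem mem_ringJacobson_of_forall_isUnit {x : R} (hx : ∀ b : R, IsUnit (1 - b * x)) :
    x ∈ Ring.jacobson R := by
  rw [← Ideal.jacobson_bot, Ideal.mem_jacobson_iff]
  intro y
  obtain ⟨z, hz⟩ := (hx (-y)).exists_left_inv
  refine ⟨z, ?_⟩
  rw [Ideal.mem_bot, ← hz]; noncomm_ring

namespace IsLocalRing

variable [IsLocalRing R]

theorem isUnit_one_sub_of_not_isUnit {x : R} (hx : ¬ IsUnit x) : IsUnit (1 - x) :=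
  (isUnit_or_isUnit_of_add_one (add_sub_cancel x 1)).resolve_left hx

theorem eq_zero_or_eq_one_of_isIdempotentElem {e : R} (he : IsIdempotentElem e) :
    e = 0 ∨ e = 1 := by
  rcases isUnit_or_isUnit_of_add_one (add_sub_cancel e 1) with h | h
  · exact Or.inr (h.mul_left_cancel (by rw [he.eq, mul_one]))
  · exact Or.inl (h.mul_left_cancel (by rw [sub_mul, one_mul, he.eq, sub_self, mul_zero]))

/-- The idempotent `x * y` is `0` or `1`, and `0` would force `1 = 0`. -/
theorem isUnit_of_mul_eq_one_left {x y : R} (h : y * x = 1) : IsUnit x := by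
  have he : IsIdempotentElem (x * y) := by
    rw [IsIdempotentElem, mul_assoc, ← mul_assoc y, h, one_mul]
  rcases eq_zero_or_eq_one_of_isIdempotentElem he with h0 | h1
  · have : (1 : R) = 0 := by
      calc (1 : R) = y * (x * y) * x := by rw [← mul_assoc, h, one_mul, h]
        _ = 0 := by rw [h0, mul_zero, zero_mul]
    exact absurd this one_ne_zero
  · exact ⟨⟨x, y, h1, h⟩, rfl⟩

theorem mem_ringJacobson_of_not_isUnit {x : R} (hx : ¬ IsUnit x) : x ∈ Ring.jacobson R := by
  refine mem_ringJacobson_of_forall_isUnit fun b => isUnit_one_sub_of_not_isUnit fun hb => hx ?_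
  obtain ⟨c, hc⟩ := hb.exists_left_inv
  exact isUnit_of_mul_eq_one_left (y := c * b) (by rw [mul_assoc, hc])

/-- Over a local ring, an identity matrix that factors through `n` up to non-units has size at
most `n`. -/
theorem card_le_of_not_isUnit_one_sub_mul {l n : Type*} [Fintype l] [Fintype n] [DecidableEq l]
    (M : Matrix l n R) (N : Matrix n l R)
    (h : ∀ i j, ¬ IsUnit ((1 - M * N : Matrix l l R) i j)) : Fintype.card l ≤ Fintype.card n := by
  let D := R ⧸ Ring.jacobson R
  let q : R →+* D := Ideal.Quotient.mk (Ring.jacobson R)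
  have hne : Nontrivial D := by
    refine Ideal.Quotient.nontrivial_iff.2 fun htop => ?_
    have := isUnit_one_sub_of_mem_ringJacobson
      (htop ▸ Submodule.mem_top : (1 : R) ∈ Ring.jacobson R)
    simp at this
  let : DivisionRing D := DivisionRing.ofIsUnitOrEqZero fun a => by
    obtain ⟨x, rfl⟩ := Ideal.Quotient.mk_surjective a
    by_cases hx : IsUnit x
    · exact Or.inl (hx.map q)
    · exact Or.inr (Ideal.Quotient.eq_zero_iff_mem.2 (mem_ringJacobson_of_not_isUnit hx))
  have hMN : M.map q * N.map q = 1 := by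
    have h0 : (1 - M * N).map q = 0 := by
      ext i j
      exact Ideal.Quotient.eq_zero_iff_mem.2 (mem_ringJacobson_of_not_isUnit (h i j))
    rw [Matrix.map_sub _ (map_sub q), Matrix.map_mul, Matrix.map_one _ (map_zero q) (map_one q),
      sub_eq_zero] at h0
    exact h0.symm
  -- Modulo the radical `M * N = 1`, so `M` embeds `D^l` into `D^n`.
  refine card_le_of_injective (R := D) (M.map q).vecMulLinear ?_
  refine Function.LeftInverse.injective (g := (N.map q).vecMulLinear) fun x => ?_
  rw [Matrix.vecMulLinear_apply, Matrix.vecMulLinear_apply, Matrix.vecMul_vecMul, hMN,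
    Matrix.vecMul_one]

end IsLocalRing

end LocalRing

/-! ### Retracts of local and of indecomposable objects. -/

section Retract

variable {C : Type u} [Category.{v} C] [Preadditive C]

theorem isIso_id_sub_comp_comm {X Y : C} (f : X ⟶ Y) (g : Y ⟶ X) [IsIso (𝟙 X - f ≫ g)] :
    IsIso (𝟙 Y - g ≫ f) := by
  have h₁ := IsIso.hom_inv_id (𝟙 X - f ≫ g)
  have h₂ := IsIso.inv_hom_id (𝟙 X - f ≫ g)
  generalize inv (𝟙 X - f ≫ g) = t at h₁ h₂
  rw [Preadditive.sub_comp, Category.id_comp, Category.assoc, sub_eq_iff_eq_add] at h₁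
  rw [Preadditive.comp_sub, Category.comp_id, sub_eq_iff_eq_add] at h₂
  -- The ring identity `(1 - gf)⁻¹ = 1 + g (1 - fg)⁻¹ f`.
  refine ⟨𝟙 Y + g ≫ t ≫ f, ?_, ?_⟩
  · have := g ≫= h₁ =≫ f
    simp only [Preadditive.comp_add, Preadditive.add_comp, Category.assoc, Category.id_comp] at this
    rw [Preadditive.comp_add, Category.comp_id, Preadditive.sub_comp, Category.id_comp,
      Category.assoc, sub_add_eq_add_sub, add_sub_assoc, sub_sub, add_comm _ (g ≫ f), ← this,
      sub_self, add_zero]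
  · have := g ≫= h₂ =≫ f
    simp only [Preadditive.comp_add, Preadditive.add_comp, Category.assoc, Category.id_comp] at this
    rw [Preadditive.add_comp, Category.id_comp, Preadditive.comp_sub, Category.comp_id,
      Category.assoc, Category.assoc, sub_add_eq_add_sub, add_sub_assoc, sub_sub,
      add_comm _ (g ≫ f), ← this, sub_self, add_zero]

theorem not_isZero_of_isLocalRing_end (X : C) [IsLocalRing (End X)] : ¬ IsZero X := fun h =>
  one_ne_zero (α := End X) (h.eq_of_src _ _)

theorem isLocalRing_end_of_iso {X Y : C} (e : X ≅ Y) [IsLocalRing (End X)] :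
    IsLocalRing (End Y) := by
  have : Nontrivial (End Y) := by
    refine ⟨1, 0, fun h => not_isZero_of_isLocalRing_end X ?_⟩
    exact ((IsZero.iff_id_eq_zero Y).2 h).of_iso e
  refine ⟨fun {a b} hab => ?_⟩
  have hab' : e.symm.conj a + e.symm.conj b = 1 := by
    have : e.symm.conj (a + b) = e.symm.conj a + e.symm.conj b := by
      simp only [Iso.conj_apply]
      erw [Preadditive.add_comp, Preadditive.comp_add]
    rw [← this, hab, map_one]
  exact (IsLocalRing.isUnit_or_isUnit_of_add_one hab').imp
    (MulEquiv.isUnit_map _).1 (MulEquiv.isUnit_map _).1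

theorem isIso_of_retract_of_isLocalRing_end {Z X : C} [IsLocalRing (End X)] (hZ : ¬ IsZero Z)
    (k : Z ⟶ X) (p : X ⟶ Z) (h : k ≫ p = 𝟙 Z) : IsIso k := by
  have he : IsIdempotentElem (M := End X) (p ≫ k) := by
    change (p ≫ k) ≫ p ≫ k = p ≫ k
    rw [Category.assoc, ← Category.assoc k, h, Category.id_comp]
  rcases IsLocalRing.eq_zero_or_eq_one_of_isIdempotentElem he with h0 | h1
  · refine absurd ((IsZero.iff_id_eq_zero Z).2 ?_) hZ
    change p ≫ k = 0 at h0
    calc 𝟙 Z = k ≫ (p ≫ k) ≫ p := by rw [Category.assoc, h, Category.comp_id, h]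
      _ = 0 := by rw [h0, zero_comp, comp_zero]
  · exact ⟨p, h, h1⟩

/-- Splitting the complementary idempotent `𝟙 B - p ≫ k` gives `B ≅ X ⊞ Z`, whence `Z = 0`. -/
theorem isIso_of_retract_of_indecomposable [HasBinaryBiproducts C] [IsIdempotentComplete C]
    {X B : C} (hX : ¬ IsZero X) (hB : Indecomposable B) (k : X ⟶ B) (p : B ⟶ X)
    (h : k ≫ p = 𝟙 X) : IsIso k := by
  have h' {W : C} (q : X ⟶ W) : k ≫ p ≫ q = q := by rw [← Category.assoc, h, Category.id_comp]
  obtain ⟨Z, i, e, hie, hei⟩ := IsIdempotentComplete.idempotents_split B (𝟙 B - p ≫ k) (by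
    simp [Preadditive.sub_comp, Preadditive.comp_sub, h'])
  have hke : k ≫ e = 0 := by
    calc k ≫ e = k ≫ (e ≫ i) ≫ e := by rw [Category.assoc, hie, Category.comp_id]
      _ = 0 := by simp [hei, Preadditive.sub_comp, Preadditive.comp_sub, h']
  have hip : i ≫ p = 0 := by
    calc i ≫ p = i ≫ (e ≫ i) ≫ p := by rw [Category.assoc, ← Category.assoc i, hie, Category.id_comp]
      _ = 0 := by simp [hei, Preadditive.sub_comp, h]
  have hZ : IsZero Z := (hB.2 X Z
    { hom := biprod.lift p e
      inv := biprod.desc k i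
      hom_inv_id := by rw [biprod.lift_desc, hei]; abel
      inv_hom_id := by ext <;> simp [h, hke, hip, hie] }).resolve_left hX
  refine ⟨p, h, ?_⟩
  have : e ≫ i = 0 := by rw [hZ.eq_of_tgt e 0, zero_comp]
  rw [hei, sub_eq_zero] at this
  exact this.symm

end Retract

/-! ### Retracts of coproducts of local objects. -/

section Cofan

variable {C : Type u} [Category.{v} C] [Preadditive C]

open Classical in
/-- The projection of a coproduct onto one of its components. -/
noncomputable def cofanProj {I : Type*} {A : I → C} {a : Cofan A} (ha : IsColimit a) (i : I) :
    a.pt ⟶ A i :=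
  Cofan.IsColimit.desc ha fun j => if h : j = i then eqToHom (by rw [h]) else 0

variable {I : Type w} {A : I → C} {a : Cofan A} (ha : IsColimit a)

@[simp]
theorem inj_cofanProj_self (i : I) : a.inj i ≫ cofanProj ha i = 𝟙 (A i) := by
  simp [cofanProj]

@[simp]
theorem inj_cofanProj_self_assoc (i : I) {Z : C} (h : A i ⟶ Z) :
    a.inj i ≫ cofanProj ha i ≫ h = h := by
  rw [← Category.assoc, inj_cofanProj_self, Category.id_comp]

theorem inj_cofanProj_of_ne {i j : I} (h : j ≠ i) : a.inj j ≫ cofanProj ha i = 0 := by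
  simp [cofanProj, h]

variable [HasFiniteBiproducts C]

theorem IsCompactObj.exists_finset {K : C} (hK : IsCompactObj.{w} K) (f : K ⟶ a.pt) :
    ∃ F : Finset I, f = ∑ i ∈ F, f ≫ cofanProj ha i ≫ a.inj i ∧
      ∀ i ∉ F, f ≫ cofanProj ha i = 0 := by
  classical
  obtain ⟨F, g, rfl⟩ := hK I A a ⟨ha⟩ f
  have hg : g ≫ biproduct.desc (fun j : F => a.inj (j : I)) =
      ∑ j : F, g ≫ biproduct.π (fun j : F => A j) j ≫ a.inj (j : I) := by
    rw [← Preadditive.comp_sum]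
    congr 1
    ext j
    rw [biproduct.ι_desc, Preadditive.comp_sum, Finset.sum_eq_single j]
    · simp
    · intro k _ hk
      rw [biproduct.ι_π_ne_assoc _ hk.symm, zero_comp]
    · simp
  have hmem : ∀ j : F, (g ≫ biproduct.desc (fun j : F => a.inj (j : I))) ≫ cofanProj ha j =
      g ≫ biproduct.π (fun j : F => A j) j := by
    intro j
    rw [hg, Preadditive.sum_comp, Finset.sum_eq_single j]
    · simp
    · intro k _ hk
      simp [inj_cofanProj_of_ne ha (fun h => hk (Subtype.ext h) : (k : I) ≠ j)]
    · simp
  refine ⟨F, ?_, fun i hi => ?_⟩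
  · rw [← Finset.sum_coe_sort]
    conv_lhs => rw [hg]
    exact Finset.sum_congr rfl fun j _ => by
      have := hmem j =≫ a.inj (j : I)
      simpa only [Category.assoc] using this.symm
  · rw [hg, Preadditive.sum_comp]
    refine Finset.sum_eq_zero fun j _ => ?_
    simp [inj_cofanProj_of_ne ha (fun h => hi (h ▸ j.2) : (j : I) ≠ i)]

/-- A nonzero retract `B` of a coproduct of objects with local endomorphism rings shares a
nonzero retract with one of the components. -/
theorem exists_isIso_of_retract (hC : HasEnoughCompacts.{w} C) (hA : ∀ i, IsLocalRing (End (A i)))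
    {B : C} (hB : ¬ IsZero B) (s : B ⟶ a.pt) (r : a.pt ⟶ B) (hsr : s ≫ r = 𝟙 B) :
    ∃ (i : I) (t : B ⟶ B), IsIso (a.inj i ≫ r ≫ t ≫ s ≫ cofanProj ha i) := by
  by_contra! hcon
  obtain ⟨K, f, hK, hf⟩ := hC B hB
  obtain ⟨F, hF, -⟩ := hK.exists_finset ha (f ≫ s)
  let x : I → End B := fun i => s ≫ cofanProj ha i ≫ a.inj i ≫ r
  have hrad : ∀ i, x i ∈ Ring.jacobson (End B) := by
    refine fun i => mem_ringJacobson_of_forall_isUnit fun t => ?_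
    rw [isUnit_iff_isIso]
    have := hA i
    let y : End (A i) := a.inj i ≫ r ≫ t ≫ s ≫ cofanProj ha i
    have hu : IsUnit (1 - y) := IsLocalRing.isUnit_one_sub_of_not_isUnit fun h => hcon i t ((isUnit_iff_isIso _).1 h)
    rw [isUnit_iff_isIso] at hu
    have : IsIso (𝟙 (A i) - (a.inj i ≫ r ≫ t) ≫ s ≫ cofanProj ha i) := by
      simp only [Category.assoc]
      exact hu
    have := isIso_id_sub_comp_comm (a.inj i ≫ r ≫ t) (s ≫ cofanProj ha i)
    -- Multiplication in `End B` is composition in reverse order: `t * x i` is `x i ≫ t`.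
    change IsIso (𝟙 B - (s ≫ cofanProj ha i ≫ a.inj i ≫ r) ≫ t)
    simpa only [Category.assoc] using this
  have hunit := isUnit_one_sub_of_mem_ringJacobson (Ideal.sum_mem _ fun i (_ : i ∈ F) => hrad i)
  rw [isUnit_iff_isIso] at hunit
  have hzero : f ≫ (𝟙 B - ∑ i ∈ F, s ≫ cofanProj ha i ≫ a.inj i ≫ r) = 0 := by
    rw [Preadditive.comp_sub, Category.comp_id, sub_eq_zero, Preadditive.comp_sum]
    have := hF =≫ r
    simpa only [Preadditive.sum_comp, Category.assoc, hsr, Category.comp_id] using this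
  have : Mono (𝟙 B - ∑ i ∈ F, s ≫ cofanProj ha i ≫ a.inj i ≫ r) :=
    @IsIso.mono_of_iso _ _ _ _ _ hunit
  exact hf (zero_of_comp_mono _ hzero)

theorem exists_iso_of_indecomposable_retract [HasBinaryBiproducts C] [IsIdempotentComplete C]
    (ha : IsColimit a) (hC : HasEnoughCompacts.{w} C) (hA : ∀ i, IsLocalRing (End (A i)))
    {B : C} (hB : Indecomposable B) (s : B ⟶ a.pt) (r : a.pt ⟶ B) (hsr : s ≫ r = 𝟙 B) :
    ∃ i, Nonempty (B ≅ A i) := by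
  obtain ⟨i, t, ht⟩ := exists_isIso_of_retract ha hC hA hB.1 s r hsr
  have := hA i
  have := isIso_of_retract_of_indecomposable (not_isZero_of_isLocalRing_end (A i)) hB
    (a.inj i ≫ r) (t ≫ s ≫ cofanProj ha i ≫ inv (a.inj i ≫ r ≫ t ≫ s ≫ cofanProj ha i)) (by
      simpa only [Category.assoc] using IsIso.hom_inv_id (a.inj i ≫ r ≫ t ≫ s ≫ cofanProj ha i))
  exact ⟨i, ⟨(asIso (a.inj i ≫ r)).symm⟩⟩

/-- A retract with local endomorphism ring is isomorphic to a component, both through the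
inclusion followed by the retraction and through the section followed by the projection. -/
theorem exists_isIso_of_isLocalRing_retract (hC : HasEnoughCompacts.{w} C)
    (hA : ∀ i, IsLocalRing (End (A i))) {T : C} [IsLocalRing (End T)]
    (s : T ⟶ a.pt) (r : a.pt ⟶ T) (hsr : s ≫ r = 𝟙 T) :
    ∃ i, IsIso (a.inj i ≫ r) ∧ IsIso (s ≫ cofanProj ha i) := by
  obtain ⟨i, t, ht⟩ := exists_isIso_of_retract ha hC hA (not_isZero_of_isLocalRing_end T) s r hsr
  have := hA i
  have hAi := not_isZero_of_isLocalRing_end (A i)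
  have h₁ : IsIso (a.inj i ≫ r) := isIso_of_retract_of_isLocalRing_end hAi (a.inj i ≫ r)
    (t ≫ s ≫ cofanProj ha i ≫ inv (a.inj i ≫ r ≫ t ≫ s ≫ cofanProj ha i)) (by
      simpa only [Category.assoc] using IsIso.hom_inv_id (a.inj i ≫ r ≫ t ≫ s ≫ cofanProj ha i))
  -- The same isomorphism also exhibits `A i` as a retract of `T` with retraction `s ≫ cofanProj ha
  -- i`.
  have hid : (inv (a.inj i ≫ r ≫ t ≫ s ≫ cofanProj ha i) ≫ a.inj i ≫ r ≫ t) ≫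
      (s ≫ cofanProj ha i) = 𝟙 (A i) := by
    simpa only [Category.assoc] using IsIso.inv_hom_id (a.inj i ≫ r ≫ t ≫ s ≫ cofanProj ha i)
  have h₂ := isIso_of_retract_of_isLocalRing_end hAi _ _ hid
  have : IsIso ((inv (a.inj i ≫ r ≫ t ≫ s ≫ cofanProj ha i) ≫ a.inj i ≫ r ≫ t) ≫
      (s ≫ cofanProj ha i)) := by rw [hid]; infer_instance
  exact ⟨i, h₁, IsIso.of_isIso_comp_left
    (inv (a.inj i ≫ r ≫ t ≫ s ≫ cofanProj ha i) ≫ a.inj i ≫ r ≫ t) _⟩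

end Cofan

/-! ### Comparison of multiplicities. -/

section Counting

variable {C : Type u} [Category.{v} C] [Preadditive C] [HasFiniteBiproducts C]
  {I : Type w} {A : I → C} {a : Cofan A} {J : Type w} {B : J → C} {b : Cofan B}

/-- A non-zero map from a compact object to `T` stays non-zero after each such isomorphism, yet only
finitely many components of its composite with `s` are non-zero. -/
theorem finite_setOf_isIso_comp_cofanProj (ha : IsColimit a) (hC : HasEnoughCompacts.{w} C)
    {T : C} (hT : ¬ IsZero T) (s : T ⟶ a.pt) : {i | IsIso (s ≫ cofanProj ha i)}.Finite := by
  obtain ⟨K, f, hK, hf⟩ := hC T hT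
  obtain ⟨F, -, hF⟩ := hK.exists_finset ha (f ≫ s)
  refine F.finite_toSet.subset fun i hi => ?_
  by_contra hiF
  have hi' : IsIso (s ≫ cofanProj ha i) := hi
  refine hf (zero_of_comp_mono (s ≫ cofanProj ha i) ?_)
  rw [← Category.assoc]
  exact hF i hiF

theorem card_iso_le_of_finite (ha : IsColimit a) (hb : IsColimit b)
    (hC : HasEnoughCompacts.{w} C) (hB : ∀ j, IsLocalRing (End (B j)))
    (φ : a.pt ≅ b.pt) (T : C) [IsLocalRing (End T)] [Fintype {i // Nonempty (A i ≅ T)}]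
    [Fintype {j // Nonempty (B j ≅ T)}] :
    Fintype.card {i // Nonempty (A i ≅ T)} ≤ Fintype.card {j // Nonempty (B j ≅ T)} := by
  classical
  let e (i : {i // Nonempty (A i ≅ T)}) : A i ≅ T := i.2.some
  let d (j : {j // Nonempty (B j ≅ T)}) : B j ≅ T := j.2.some
  let s (i : {i // Nonempty (A i ≅ T)}) : T ⟶ b.pt := (e i).inv ≫ a.inj i ≫ φ.hom
  let r (i : {i // Nonempty (A i ≅ T)}) : b.pt ⟶ T := φ.inv ≫ cofanProj ha i ≫ (e i).hom
  let M : Matrix {i // Nonempty (A i ≅ T)} {j // Nonempty (B j ≅ T)} (End T) :=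
    fun i j => (d j).inv ≫ b.inj j ≫ r i
  let N : Matrix {j // Nonempty (B j ≅ T)} {i // Nonempty (A i ≅ T)} (End T) :=
    fun j i => s i ≫ cofanProj hb j ≫ (d j).hom
  -- The projection onto the summands of type `T`. The entries of `1 - M * N` are `s i' ≫ (𝟙 - π) ≫
  -- r i`; a unit among them would make `T` a retract through `𝟙 - π`, hence isomorphic to some `B
  -- j` that `𝟙 - π` kills.
  let π : b.pt ⟶ b.pt := ∑ j : {j // Nonempty (B j ≅ T)}, cofanProj hb j ≫ b.inj j
  have hπ (j : {j // Nonempty (B j ≅ T)}) : π ≫ cofanProj hb j = cofanProj hb j := by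
    rw [Preadditive.sum_comp, Finset.sum_eq_single j]
    · simp
    · intro k _ hk
      rw [Category.assoc, inj_cofanProj_of_ne hb fun h => hk (Subtype.ext h), comp_zero]
    · simp
  have hone (i i') : (1 : Matrix _ _ (End T)) i i' = s i' ≫ r i := by
    by_cases h : i = i'
    · subst h
      simp [s, r, End.one_def]
    · rw [Matrix.one_apply_ne h]
      simp only [s, r, Category.assoc, Iso.hom_inv_id_assoc]
      have := inj_cofanProj_of_ne ha (fun h' => h (Subtype.ext h'.symm) : (i' : I) ≠ i)
      rw [← Category.assoc (a.inj _), this, zero_comp, comp_zero]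
  have hmul (i i') : (M * N) i i' = s i' ≫ π ≫ r i := by
    rw [Matrix.mul_apply, Preadditive.sum_comp, Preadditive.comp_sum]
    refine Finset.sum_congr rfl fun j _ => ?_
    simp [M, N, End.mul_def]
  refine IsLocalRing.card_le_of_not_isUnit_one_sub_mul M N fun i i' hu => ?_
  rw [Matrix.sub_apply, hone, hmul, isUnit_iff_isIso] at hu
  have hu' : IsIso ((s i' ≫ (𝟙 _ - π)) ≫ r i) := by
    simpa only [Category.assoc, Preadditive.comp_sub, Preadditive.sub_comp, Category.id_comp]
      using hu
  obtain ⟨j, -, hj⟩ := exists_isIso_of_isLocalRing_retract hb hC hB (s i' ≫ (𝟙 _ - π))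
    (r i ≫ inv ((s i' ≫ (𝟙 _ - π)) ≫ r i)) (by
      rw [← Category.assoc]
      exact IsIso.hom_inv_id _)
  have hzero := hπ ⟨j, ⟨(asIso ((s i' ≫ (𝟙 _ - π)) ≫ cofanProj hb j)).symm⟩⟩
  have : (s i' ≫ (𝟙 _ - π)) ≫ cofanProj hb j = 0 := by
    rw [Category.assoc, Preadditive.sub_comp, Category.id_comp, hzero, sub_self, comp_zero]
  refine not_isZero_of_isLocalRing_end T ((IsZero.iff_id_eq_zero T).2 ?_)
  refine zero_of_comp_mono ((s i' ≫ (𝟙 _ - π)) ≫ cofanProj hb j) ?_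
  rw [Category.id_comp, this]

theorem mk_iso_le (ha : IsColimit a) (hb : IsColimit b)
    (hC : HasEnoughCompacts.{w} C) (hA : ∀ i, IsLocalRing (End (A i)))
    (hB : ∀ j, IsLocalRing (End (B j))) (φ : a.pt ≅ b.pt) (T : C) :
    Cardinal.mk {i // Nonempty (A i ≅ T)} ≤ Cardinal.mk {j // Nonempty (B j ≅ T)} := by
  rcases finite_or_infinite {i // Nonempty (A i ≅ T)} with hI | hI
  · rcases finite_or_infinite {j // Nonempty (B j ≅ T)} with hJ | hJ
    · rcases isEmpty_or_nonempty {i // Nonempty (A i ≅ T)} with hE | ⟨⟨i, ⟨e⟩⟩⟩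
      · rw [Cardinal.mk_eq_zero]
        exact zero_le
      · have := hA i
        have := isLocalRing_end_of_iso e
        have := Fintype.ofFinite {i // Nonempty (A i ≅ T)}
        have := Fintype.ofFinite {j // Nonempty (B j ≅ T)}
        rw [Cardinal.mk_fintype, Cardinal.mk_fintype]
        exact_mod_cast card_iso_le_of_finite ha hb hC hB φ T
    · exact (Cardinal.mk_le_aleph0).trans (Cardinal.aleph0_le_mk _)
  -- Too small a target would give `g` an infinite fibre, while a single `B j` has isomorphic
  -- components in only finitely many `A i`.
  · by_contra! hlt
    have hex (i : {i // Nonempty (A i ≅ T)}) : ∃ j : {j // Nonempty (B j ≅ T)},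
        IsIso ((b.inj j ≫ φ.inv) ≫ cofanProj ha i) := by
      have := hA i
      obtain ⟨j, hj, -⟩ := exists_isIso_of_isLocalRing_retract hb hC hB
        (a.inj i ≫ φ.hom) (φ.inv ≫ cofanProj ha i) (by simp)
      refine ⟨⟨j, ⟨asIso (b.inj j ≫ φ.inv ≫ cofanProj ha i) ≪≫ i.2.some⟩⟩, ?_⟩
      rwa [Category.assoc]
    choose g hg using hex
    obtain ⟨j, hj⟩ := Cardinal.exists_infinite_fiber g hlt
    have := hB j
    have hfin := finite_setOf_isIso_comp_cofanProj ha hC (not_isZero_of_isLocalRing_end (B j))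
      (b.inj j ≫ φ.inv)
    refine Set.infinite_coe_iff.1 hj ((hfin.preimage Subtype.val_injective.injOn).subset ?_)
    rintro i rfl
    exact hg i

end Counting

theorem theorem4p1 {C : Type u} [Category.{v} C] [Preadditive C] [HasFiniteBiproducts C]
    [HasBinaryBiproducts C] [IsIdempotentComplete C] (hC : HasEnoughCompacts.{w} C)
    {I : Type w} (A : I → C) (hA : ∀ i, IsLocalRing (End (A i)))
    (a : Cofan A) (ha : IsColimit a) :
    (∀ B : C, Indecomposable B → IsDirectSummand B a.pt → ∃ i, Nonempty (B ≅ A i)) ∧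
    (∀ (J : Type w) (B : J → C) (b : Cofan B), IsColimit b → (∀ j, Indecomposable (B j)) →
      Nonempty (a.pt ≅ b.pt) → ∃ σ : I ≃ J, ∀ i, Nonempty (A i ≅ B (σ i))) := by
  refine ⟨fun B hB ⟨D, ⟨ψ⟩⟩ => ?_, fun J B b hb hB ⟨φ⟩ => ?_⟩
  · exact exists_iso_of_indecomposable_retract ha hC hA hB (biprod.inl ≫ ψ.inv)
      (ψ.hom ≫ biprod.fst) (by simp)
  · have hB' (j : J) : IsLocalRing (End (B j)) := by
      obtain ⟨i, ⟨e⟩⟩ := exists_iso_of_indecomposable_retract ha hC hA (hB j)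
        (b.inj j ≫ φ.inv) (φ.hom ≫ cofanProj hb j) (by simp)
      have := hA i
      exact isLocalRing_end_of_iso e.symm
    have hcard (c : Quotient (isIsomorphicSetoid C)) :
        Nonempty ({i // (⟦A i⟧ : Quotient (isIsomorphicSetoid C)) = c} ≃
          {j // (⟦B j⟧ : Quotient (isIsomorphicSetoid C)) = c}) := by
      induction c using Quotient.inductionOn with
      | h T =>
        simp only [Quotient.eq]
        exact Cardinal.eq.1 (le_antisymm (mk_iso_le ha hb hC hA hB' φ T)
          (mk_iso_le hb ha hC hB' hA φ.symm T))
    -- Bijections chosen on each isomorphism class glue to one of the index sets.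
    refine ⟨Equiv.ofFiberEquiv fun c => (hcard c).some, fun i => ?_⟩
    exact Quotient.exact (Equiv.ofFiberEquiv_map (fun c => (hcard c).some) i).symm
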